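/- Let $q$ be a complex number with $|q|<1$. Write $(a;q)_n=\prod_{i=0}^{n-1}(1-aq^i)$, $(a;q)_\infty=\prod_{i=0}^{\infty}(1-aq^i)$ and $\phi(q)=\sum_{n=-\infty}^{\infty}q^{n^2}$. Then all series and products below converge, none of the denominators vanishes, and $$ \frac{\phi^3(-q)}{\phi(-q^3)}=1-\frac{6}{(-q;q^3)_\infty}\sum_{n=1}^{\infty}\frac{n\,q^{(3n^2-n)/2}}{(q^3;q^3)_n}+\frac{6}{(-q^2;q^3)_\infty}\sum_{n=1}^{\infty}\frac{n\,q^{(3n^2+n)/2}}{(q^3;q^3)_n} $$ $$ =1+6(-q;q^3)_\infty\sum_{n=1}^{\infty}\frac{n(-1)^nq^{n}}{(q^3;q^3)_n}-6(-q^2;q^3)_\infty\sum_{n=1}^{\infty}\frac{n(-1)^nq^{2n}}{(q^3;q^3)_n}. $$ -/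

import Mathlib

noncomputable section

/-- The finite `q`-shifted factorial `(a;q)_n = (1 - a)(1 - aq)⋯(1 - aq^(n-1))`. -/
def qPoch (a q : ℂ) (n : ℕ) : ℂ := ∏ i ∈ Finset.range n, (1 - a * q ^ i)

/-- The infinite `q`-shifted factorial `(a;q)_∞ = (1 - a)(1 - aq)(1 - aq^2)⋯`. -/
def qPochInf (a q : ℂ) : ℂ := ∏' i : ℕ, (1 - a * q ^ i)

/-- Ramanujan's theta function `φ(q) = ∑_{n ∈ ℤ} q^(n^2)`. -/
def ramanujanPhi (q : ℂ) : ℂ := ∑' n : ℤ, q ^ (n ^ 2)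

end

/-!
Let `L` be the derivative of `log (x;q³)_∞` with respect to `log x`. Euler's expansions of
`(x;q³)_∞` and of its reciprocal as power series in `x`, differentiated termwise at `x = -q` and
`x = -q²`, express the sums in both identities through `L(-q)` and `L(-q²)`, and both right-hand
sides become `1 - 6 (L(-q) - L(-q²))`.

To see that this is `φ(-q)³ / φ(-q³)`, put `T(z;p) = (p;p)_∞ (-z;p)_∞ (-p/z;p)_∞`. By Jacobi's
triple product, `T(w;q) T(-qw²;q²)` is a double sum over `(a, b) ∈ ℤ²`. Splitting it by `a + 2b`
modulo `3` produces three theta constants, one of which is zero while the other two equal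
`(q²;q²)_∞`; this is the quintuple product identity. Its left side vanishes at `w = -1`, so
differentiating there leaves `(q;q)_∞³ T(-q;q²)`, while the right side yields the factor
`1 - 6 (L(-q) - L(-q²))`. Gauss's product `φ(-q) = (q;q)_∞ / (-q;q)_∞` then turns the infinite
products into theta functions.
-/

open Filter Topology Metric

section PowerSeries

variable {c : ℕ → ℂ} {F : ℂ → ℂ} {r : ℝ} {x : ℂ}

lemma summable_of_succ_eq_mul {R : Type*} [NormedRing R] [CompleteSpace R] {t m : ℕ → R} {l : R}
    (hl : ‖l‖ < 1) (hm : Tendsto m atTop (𝓝 l)) (h : ∀ n, t (n + 1) = m n * t n) :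
    Summable t := by
  obtain ⟨ρ, hlρ, hρ⟩ := exists_between hl
  refine summable_of_ratio_norm_eventually_le hρ ?_
  filter_upwards [hm.norm.eventually_lt_const hlρ] with n hn
  calc ‖t (n + 1)‖ ≤ ‖m n‖ * ‖t n‖ := h n ▸ norm_mul_le _ _
    _ ≤ ρ * ‖t n‖ := by gcongr

lemma exists_majorant_of_summable_mul_pow (hc : ∀ y ∈ ball 0 r, Summable fun n => c n * y ^ n)
    (hx : x ∈ ball 0 r) :
    ∃ ρ ≤ r, x ∈ ball 0 ρ ∧
      ∃ u : ℕ → ℝ, Summable u ∧ ∀ n, ∀ y ∈ ball 0 ρ, ‖c n * y ^ n‖ ≤ u n := by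
  simp only [mem_ball_zero_iff] at *
  obtain ⟨ρ, hxρ, hρr⟩ := exists_between hx
  have hρ : ‖(ρ : ℂ)‖ = ρ := Complex.norm_of_nonneg ((norm_nonneg x).trans hxρ.le)
  refine ⟨ρ, hρr.le, hxρ, _, (hc ρ (hρ.symm ▸ hρr)).norm, fun n y hy => ?_⟩
  rw [norm_mul, norm_mul, norm_pow, norm_pow, hρ]
  gcongr

lemma differentiableAt_of_hasSum_mul_pow
    (hF : ∀ y ∈ ball 0 r, HasSum (fun n => c n * y ^ n) (F y)) (hx : x ∈ ball 0 r) :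
    DifferentiableAt ℂ F x := by
  obtain ⟨ρ, hρ, hxρ, u, hu, hcu⟩ :=
    exists_majorant_of_summable_mul_pow (fun y hy => (hF y hy).summable) hx
  have hdiff := Complex.differentiableOn_tsum_of_summable_norm hu
    (fun n => by fun_prop) isOpen_ball hcu
  refine (hdiff.differentiableAt (isOpen_ball.mem_nhds hxρ)).congr_of_eventuallyEq ?_
  filter_upwards [isOpen_ball.mem_nhds hxρ] with y hy
  exact (hF y (ball_subset_ball hρ hy)).tsum_eq.symm

lemma hasSum_natCast_mul_mul_pow
    (hF : ∀ y ∈ ball 0 r, HasSum (fun n => c n * y ^ n) (F y)) (hx : x ∈ ball 0 r) :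
    HasSum (fun n : ℕ => (n : ℂ) * (c n * x ^ n)) (x * deriv F x) := by
  obtain ⟨ρ, hρ, hxρ, u, hu, hcu⟩ :=
    exists_majorant_of_summable_mul_pow (fun y hy => (hF y hy).summable) hx
  have hF_eq : F =ᶠ[𝓝 x] fun y => ∑' n, c n * y ^ n := by
    filter_upwards [isOpen_ball.mem_nhds hxρ] with y hy
    exact (hF y (ball_subset_ball hρ hy)).tsum_eq.symm
  rw [hF_eq.deriv_eq]
  refine ((Complex.hasSum_deriv_of_summable_norm hu (fun n => by fun_prop) isOpen_ball hcu
    hxρ).mul_left x).congr_fun fun n => ?_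
  cases n with
  | zero => simp
  | succ n =>
    rw [deriv_const_mul_field, deriv_pow_field, Nat.add_sub_cancel]
    ring

lemma tendsto_mul_pow_of_hasSum_mul_pow {p : ℂ} (hp : ‖p‖ < 1) (hr : 0 < r)
    (hF : ∀ y ∈ ball 0 r, HasSum (fun n => c n * y ^ n) (F y)) (x : ℂ) :
    Tendsto (fun k : ℕ => F (x * p ^ k)) atTop (𝓝 (c 0)) := by
  have hF0 : F 0 = c 0 := by
    simpa using (hF 0 (mem_ball_self hr)).unique (hasSum_single 0 fun n hn => by simp [hn])
  have hpow : Tendsto (fun k : ℕ => x * p ^ k) atTop (𝓝 0) := by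
    simpa using (tendsto_pow_atTop_nhds_zero_of_norm_lt_one hp).const_mul x
  exact hF0 ▸ (differentiableAt_of_hasSum_mul_pow hF (mem_ball_self hr)).continuousAt.tendsto.comp
    hpow

lemma hasSum_one_sub_pow_mul {p s s' : ℂ} (h : HasSum (fun n => c n * x ^ n) s)
    (h' : HasSum (fun n => c n * (x * p) ^ n) s') :
    HasSum (fun n => (1 - p ^ (n + 1)) * c (n + 1) * x ^ n * x) (s - s') := by
  have hsub := (hasSum_nat_add_iff' 1).2 (h.sub h')
  simp only [Finset.sum_range_one, pow_zero, sub_self, sub_zero] at hsub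
  exact hsub.congr_fun fun n => by ring

end PowerSeries

section QPochhammer

variable {p x : ℂ}

lemma norm_pow_lt_one {R : Type*} [NormedDivisionRing R] {a : R} (ha : ‖a‖ < 1) (k : ℕ)
    [NeZero k] : ‖a ^ k‖ < 1 := by
  rw [norm_pow]
  exact pow_lt_one₀ (norm_nonneg _) ha (NeZero.ne k)

lemma qPoch_succ (x p : ℂ) (n : ℕ) : qPoch x p (n + 1) = qPoch x p n * (1 - x * p ^ n) :=
  Finset.prod_range_succ _ _

lemma qPoch_self_succ (p : ℂ) (n : ℕ) :
    qPoch p p (n + 1) = qPoch p p n * (1 - p ^ (n + 1)) := by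
  rw [qPoch_succ, pow_succ']

@[simp] lemma qPoch_zero (x p : ℂ) : qPoch x p 0 = 1 := rfl

lemma summable_norm_neg_mul_pow (hp : ‖p‖ < 1) (x : ℂ) : Summable fun i : ℕ => ‖-(x * p ^ i)‖ := by
  simpa using (summable_geometric_of_lt_one (norm_nonneg _) hp).mul_left ‖x‖

lemma multipliable_one_sub_mul_pow (hp : ‖p‖ < 1) (x : ℂ) :
    Multipliable fun i : ℕ => 1 - x * p ^ i := by
  simpa [sub_eq_add_neg] using multipliable_one_add_of_summable (summable_norm_neg_mul_pow hp x)

lemma tendsto_qPoch (hp : ‖p‖ < 1) (x : ℂ) :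
    Tendsto (qPoch x p) atTop (𝓝 (qPochInf x p)) :=
  (multipliable_one_sub_mul_pow hp x).hasProd.tendsto_prod_nat

lemma norm_mul_pow_lt_one (hp : ‖p‖ < 1) (hx : ‖x‖ < 1) (n : ℕ) : ‖x * p ^ n‖ < 1 := by
  rw [norm_mul, norm_pow]
  exact (mul_le_of_le_one_right (norm_nonneg _) (pow_le_one₀ (norm_nonneg _) hp.le)).trans_lt hx

lemma one_sub_mul_pow_ne_zero (hp : ‖p‖ < 1) (hx : ‖x‖ < 1) (n : ℕ) : 1 - x * p ^ n ≠ 0 :=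
  (isUnit_one_sub_of_norm_lt_one (norm_mul_pow_lt_one hp hx n)).ne_zero

lemma one_sub_pow_succ_ne_zero (hp : ‖p‖ < 1) (n : ℕ) : 1 - p ^ (n + 1) ≠ 0 :=
  pow_succ' p n ▸ one_sub_mul_pow_ne_zero hp hp n

lemma qPoch_ne_zero (hp : ‖p‖ < 1) (hx : ‖x‖ < 1) (n : ℕ) : qPoch x p n ≠ 0 :=
  Finset.prod_ne_zero_iff.2 fun i _ => one_sub_mul_pow_ne_zero hp hx i

lemma qPochInf_ne_zero (hp : ‖p‖ < 1) (hx : ‖x‖ < 1) : qPochInf x p ≠ 0 := by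
  simpa [qPochInf, sub_eq_add_neg] using tprod_one_add_ne_zero_of_summable
    (fun i => by simpa [sub_eq_add_neg] using one_sub_mul_pow_ne_zero hp hx i)
    (summable_norm_neg_mul_pow hp x)

lemma tendsto_inv_qPoch_self (hp : ‖p‖ < 1) :
    Tendsto (fun n => (qPoch p p n)⁻¹) atTop (𝓝 (qPochInf p p)⁻¹) :=
  (tendsto_qPoch hp p).inv₀ (qPochInf_ne_zero hp hp)

lemma qPochInf_eq_one_sub_mul (hp : ‖p‖ < 1) (x : ℂ) :
    qPochInf x p = (1 - x) * qPochInf (x * p) p := by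
  have hshift (i : ℕ) : 1 - x * p * p ^ i = 1 - x * p ^ (i + 1) := by ring
  have hmul := multipliable_one_sub_mul_pow hp (x * p)
  simp only [hshift] at hmul
  rw [qPochInf, tprod_eq_zero_mul' (f := fun i => 1 - x * p ^ i) hmul, pow_zero, mul_one, qPochInf]
  simp only [hshift]

lemma qPochInf_one (hp : ‖p‖ < 1) : qPochInf 1 p = 0 := by
  simp [qPochInf_eq_one_sub_mul hp 1]

lemma qPochInf_eq_prod_qPochInf_pow (hp : ‖p‖ < 1) (x : ℂ) (k : ℕ) [NeZero k] :
    qPochInf x p = ∏ j : Fin k, qPochInf (x * p ^ (j : ℕ)) (p ^ k) := by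
  have hprod : HasProd (fun y : Fin k × ℕ => 1 - x * p ^ (y.1 : ℕ) * (p ^ k) ^ y.2)
      (qPochInf x p) := by
    have h := (((Nat.divModEquiv k).trans (Equiv.prodComm _ _)).symm.hasProd_iff
      (f := fun i => 1 - x * p ^ i)).2 (multipliable_one_sub_mul_pow hp x).hasProd
    refine h.congr_fun fun y => ?_
    change _ = 1 - x * p ^ (y.2 * k + y.1)
    ring
  have hfiber (j : Fin k) : HasProd (fun i => 1 - x * p ^ (j : ℕ) * (p ^ k) ^ i)
      (qPochInf (x * p ^ (j : ℕ)) (p ^ k)) :=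
    (multipliable_one_sub_mul_pow (norm_pow_lt_one hp k) _).hasProd
  exact (hprod.prod_fiberwise hfiber).unique (hasProd_fintype _)

lemma qPochInf_neg_mul (hp : ‖p‖ < 1) (x : ℂ) :
    qPochInf (-x) p * qPochInf x p = qPochInf (x ^ 2) (p ^ 2) := by
  rw [qPochInf, qPochInf, ← (multipliable_one_sub_mul_pow hp _).tprod_mul
    (multipliable_one_sub_mul_pow hp _)]
  exact tprod_congr fun i => by ring

end QPochhammer

section EulerSeries

variable {p x : ℂ}

lemma hasSum_qPochInf (hp : ‖p‖ < 1) (x : ℂ) :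
    HasSum (fun n : ℕ => (-1) ^ n * p ^ n.choose 2 / qPoch p p n * x ^ n) (qPochInf x p) := by
  set c : ℕ → ℂ := fun n => (-1) ^ n * p ^ n.choose 2 / qPoch p p n with hc
  have hrec (n : ℕ) : (1 - p ^ (n + 1)) * c (n + 1) = -p ^ n * c n := by
    have hpos := one_sub_pow_succ_ne_zero hp n
    have hpoch := qPoch_ne_zero hp hp n
    simp only [hc, qPoch_self_succ, Nat.choose_succ_succ' n 1, Nat.choose_one_right]
    field_simp
    ring
  have hsum (y : ℂ) : Summable fun n => c n * y ^ n := by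
    have hpow := tendsto_pow_atTop_nhds_zero_of_norm_lt_one hp
    have hlim : Tendsto (fun n => -p ^ n * y / (1 - p ^ (n + 1))) atTop
        (𝓝 (-0 * y / (1 - 0))) :=
      (hpow.neg.mul_const y).div (tendsto_const_nhds.sub (hpow.comp (tendsto_add_atTop_nat 1)))
        (by simp)
    refine summable_of_succ_eq_mul (by simp) hlim fun n => ?_
    have hpos := one_sub_pow_succ_ne_zero hp n
    field_simp
    linear_combination y ^ (n + 1) * hrec n
  set F : ℂ → ℂ := fun y => ∑' n, c n * y ^ n
  have hF (y : ℂ) : HasSum (fun n => c n * y ^ n) (F y) := (hsum y).hasSum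
  have hshift (y : ℂ) : F y = (1 - y) * F (y * p) := by
    have h := (hasSum_one_sub_pow_mul (hF y) (hF (y * p))).unique
      (((hF (y * p)).mul_left (-y)).congr_fun fun n => by
        linear_combination y ^ (n + 1) * hrec n)
    linear_combination h
  have hiter (k : ℕ) : F x = qPoch x p k * F (x * p ^ k) := by
    induction k with
    | zero => simp
    | succ k ih => rw [ih, hshift (x * p ^ k), qPoch_succ, pow_succ]; ring_nf
  have hlim := (tendsto_qPoch hp x).mul
    (tendsto_mul_pow_of_hasSum_mul_pow hp one_pos (fun y _ => hF y) x)
  have hFx : F x = qPochInf x p := by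
    simp only [← hiter] at hlim
    simpa [hc] using tendsto_nhds_unique tendsto_const_nhds hlim
  exact hFx ▸ hF x

lemma hasSum_inv_qPochInf (hp : ‖p‖ < 1) (hx : ‖x‖ < 1) :
    HasSum (fun n => (qPoch p p n)⁻¹ * x ^ n) (qPochInf x p)⁻¹ := by
  set c : ℕ → ℂ := fun n => (qPoch p p n)⁻¹ with hc
  have hrec (n : ℕ) : (1 - p ^ (n + 1)) * c (n + 1) = c n := by
    have hpos := one_sub_pow_succ_ne_zero hp n
    have hpoch := qPoch_ne_zero hp hp n
    simp only [hc, qPoch_self_succ]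
    field_simp
  have hsum {y : ℂ} (hy : ‖y‖ < 1) : Summable fun n => c n * y ^ n := by
    have hpow := tendsto_pow_atTop_nhds_zero_of_norm_lt_one hp
    have hlim : Tendsto (fun n => y / (1 - p ^ (n + 1))) atTop (𝓝 (y / (1 - 0))) :=
      tendsto_const_nhds.div (tendsto_const_nhds.sub (hpow.comp (tendsto_add_atTop_nat 1)))
        (by simp)
    refine summable_of_succ_eq_mul (by simpa using hy) hlim fun n => ?_
    have hpos := one_sub_pow_succ_ne_zero hp n
    field_simp
    linear_combination y ^ (n + 1) * hrec n
  set F : ℂ → ℂ := fun y => ∑' n, c n * y ^ n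
  have hF {y : ℂ} (hy : ‖y‖ < 1) : HasSum (fun n => c n * y ^ n) (F y) := (hsum hy).hasSum
  have hshift {y : ℂ} (hy : ‖y‖ < 1) : (1 - y) * F y = F (y * p) := by
    have hyp : ‖y * p‖ < 1 := by simpa using norm_mul_pow_lt_one hp hy 1
    have h := (hasSum_one_sub_pow_mul (hF hy) (hF hyp)).unique
      (((hF hy).mul_left y).congr_fun fun n => by linear_combination y ^ (n + 1) * hrec n)
    linear_combination h
  have hiter (k : ℕ) : qPoch x p k * F x = F (x * p ^ k) := by
    induction k with
    | zero => simp
    | succ k ih =>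
      rw [qPoch_succ, mul_right_comm, ih, mul_comm, hshift (norm_mul_pow_lt_one hp hx k),
        pow_succ, mul_assoc]
  have hlim := tendsto_mul_pow_of_hasSum_mul_pow hp one_pos
    (fun y hy => hF (mem_ball_zero_iff.1 hy)) x
  have hFx : qPochInf x p * F x = 1 := by
    refine tendsto_nhds_unique ((tendsto_qPoch hp x).mul_const (F x)) ?_
    simpa [hc, hiter] using hlim
  exact eq_inv_of_mul_eq_one_right hFx ▸ hF hx

lemma differentiableAt_qPochInf (hp : ‖p‖ < 1) (x : ℂ) :
    DifferentiableAt ℂ (fun y => qPochInf y p) x :=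
  differentiableAt_of_hasSum_mul_pow (r := ‖x‖ + 1) (fun y _ => hasSum_qPochInf hp y) (by simp)

/-- The derivative `x g'(x) / g(x)` of `log g` with respect to `log x`, for `g(x) = (x;p)_∞`. -/
noncomputable def qPochLogDeriv (p x : ℂ) : ℂ := x * logDeriv (fun y => qPochInf y p) x

lemma hasSum_natCast_mul_qPochInf (hp : ‖p‖ < 1) (hx : qPochInf x p ≠ 0) :
    HasSum (fun n : ℕ => (n : ℂ) * ((-1) ^ n * p ^ n.choose 2 / qPoch p p n * x ^ n))
      (qPochInf x p * qPochLogDeriv p x) := by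
  convert hasSum_natCast_mul_mul_pow (r := ‖x‖ + 1) (x := x)
    (fun y _ => hasSum_qPochInf hp y) (by simp) using 1
  rw [qPochLogDeriv, logDeriv_apply]
  field_simp

lemma hasSum_natCast_mul_inv_qPochInf (hp : ‖p‖ < 1) (hx : ‖x‖ < 1) :
    HasSum (fun n : ℕ => (n : ℂ) * ((qPoch p p n)⁻¹ * x ^ n))
      (-(qPochLogDeriv p x / qPochInf x p)) := by
  convert hasSum_natCast_mul_mul_pow (r := 1) (x := x)
    (fun y hy => hasSum_inv_qPochInf hp (mem_ball_zero_iff.1 hy)) (by simpa using hx) using 1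
  rw [deriv_fun_inv'' (differentiableAt_qPochInf hp x) (qPochInf_ne_zero hp hx),
    qPochLogDeriv, logDeriv_apply]
  field_simp

end EulerSeries

section TripleProduct

variable {p z : ℂ} {k : ℕ}

lemma exists_norm_inv_qPoch_self_le (hp : ‖p‖ < 1) : ∃ C : ℝ, ∀ n, ‖(qPoch p p n)⁻¹‖ ≤ C := by
  obtain ⟨C, hC⟩ := (tendsto_inv_qPoch_self hp).norm.bddAbove_range
  exact ⟨C, fun n => hC ⟨n, rfl⟩⟩

/-- The generating function `p^(m(m+k)) / ((p;p)_m (p;p)_(m+k))` of the partitions whose largest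
Durfee rectangle with side difference `k` has sides `m` and `m + k`. -/
noncomputable def durfeeTerm (p : ℂ) (k m : ℕ) : ℂ :=
  p ^ (m * (m + k)) / (qPoch p p m * qPoch p p (m + k))

lemma norm_durfeeTerm_le {C : ℝ} (hC : ∀ n, ‖(qPoch p p n)⁻¹‖ ≤ C) (k m : ℕ) :
    ‖durfeeTerm p k m‖ ≤ ‖p‖ ^ (m * (m + k)) * (C * C) := by
  rw [durfeeTerm, div_eq_mul_inv, mul_inv, norm_mul, norm_mul, norm_pow]
  gcongr
  · exact (norm_nonneg _).trans (hC 0)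
  · exact hC m
  · exact hC (m + k)

lemma norm_durfeeTerm_le_pow (hp : ‖p‖ < 1) {C : ℝ} (hC : ∀ n, ‖(qPoch p p n)⁻¹‖ ≤ C)
    (k m : ℕ) : ‖durfeeTerm p k m‖ ≤ ‖p‖ ^ m * (C * C) := by
  refine (norm_durfeeTerm_le hC k m).trans ?_
  gcongr ?_ * _
  · exact mul_self_nonneg C
  · exact pow_le_pow_of_le_one (norm_nonneg _) hp.le (by nlinarith [Nat.le_mul_self m])

lemma summable_norm_pow_mul (hp : ‖p‖ < 1) (C : ℝ) : Summable fun m : ℕ => ‖p‖ ^ m * C :=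
  (summable_geometric_of_lt_one (norm_nonneg _) hp).mul_right C

lemma summable_durfeeTerm (hp : ‖p‖ < 1) (k : ℕ) : Summable (durfeeTerm p k) := by
  obtain ⟨C, hC⟩ := exists_norm_inv_qPoch_self_le hp
  exact .of_norm_bounded (summable_norm_pow_mul hp (C * C)) (norm_durfeeTerm_le_pow hp hC k)

lemma one_sub_pow_mul_durfeeTerm_succ (hp : ‖p‖ < 1) (k m : ℕ) :
    (1 - p ^ (m + 1)) * durfeeTerm p k (m + 1) =
      durfeeTerm p (k + 1) m - p ^ m * durfeeTerm p k m := by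
  have hm := qPoch_ne_zero hp hp m
  have hmk := qPoch_ne_zero hp hp (m + k)
  have hm1 := one_sub_pow_succ_ne_zero hp m
  have hmk1 := one_sub_pow_succ_ne_zero hp (m + k)
  rw [durfeeTerm, durfeeTerm, durfeeTerm, show m + 1 + k = m + k + 1 by ring, ← add_assoc m k,
    qPoch_self_succ, qPoch_self_succ]
  field_simp
  ring

lemma hasSum_durfeeTerm_succ (hp : ‖p‖ < 1) {s : ℂ} (h : HasSum (durfeeTerm p k) s) :
    HasSum (durfeeTerm p (k + 1)) s := by
  have hpow : Summable fun m => p ^ m * durfeeTerm p k m := by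
    refine .of_norm_bounded (summable_durfeeTerm hp k).norm fun m => ?_
    rw [norm_mul, norm_pow]
    exact mul_le_of_le_one_left (norm_nonneg _) (pow_le_one₀ (norm_nonneg _) hp.le)
  have hshift := (hasSum_nat_add_iff' 1).2 (h.sub hpow.hasSum)
  refine ((hshift.add hpow.hasSum).congr_fun fun m => ?_).trans_eq ?_
  · linear_combination -one_sub_pow_mul_durfeeTerm_succ hp k m
  · simp

lemma tendsto_tsum_durfeeTerm (hp : ‖p‖ < 1) :
    Tendsto (fun k => ∑' m, durfeeTerm p k m) atTop (𝓝 (qPochInf p p)⁻¹) := by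
  obtain ⟨C, hC⟩ := exists_norm_inv_qPoch_self_le hp
  rw [← tsum_ite_eq 0 fun _ : ℕ => (qPochInf p p)⁻¹]
  refine tendsto_tsum_of_dominated_convergence (summable_norm_pow_mul hp (C * C)) (fun m => ?_)
    (.of_forall fun k => norm_durfeeTerm_le_pow hp hC k)
  rcases eq_or_ne m 0 with rfl | hm
  · simpa [durfeeTerm] using tendsto_inv_qPoch_self hp
  rw [if_neg hm]
  have hpow : Tendsto (fun k => ‖p‖ ^ k * (C * C)) atTop (𝓝 0) := by
    simpa using (tendsto_pow_atTop_nhds_zero_of_lt_one (norm_nonneg _) hp).mul_const (C * C)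
  refine squeeze_zero_norm (fun k => (norm_durfeeTerm_le hC k m).trans ?_) hpow
  gcongr ?_ * _
  · exact mul_self_nonneg C
  · exact pow_le_pow_of_le_one (norm_nonneg _) hp.le (by nlinarith [Nat.pos_of_ne_zero hm])

lemma hasSum_durfeeTerm (hp : ‖p‖ < 1) (k : ℕ) :
    HasSum (durfeeTerm p k) (qPochInf p p)⁻¹ := by
  -- The sum does not depend on `k`, and only the term `m = 0` survives in the limit `k → ∞`.
  have hconst (k : ℕ) : HasSum (durfeeTerm p k) (∑' m, durfeeTerm p 0 m) := by
    induction k with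
    | zero => exact (summable_durfeeTerm hp 0).hasSum
    | succ k ih => exact hasSum_durfeeTerm_succ hp ih
  have hlim := tendsto_tsum_durfeeTerm hp
  simp only [(hconst _).tsum_eq] at hlim
  exact tendsto_nhds_unique tendsto_const_nhds hlim ▸ hconst k

lemma two_mul_choose_two (n : ℤ) : 2 * Ring.choose n 2 = n * (n - 1) := by
  have h := Ring.choose_smul_choose n (n := 2) (k := 1) one_le_two
  simpa [Ring.choose_one_right] using h

/-- The general term `z^n p^(n(n-1)/2)` of the bilateral theta series of Jacobi's triple product. -/
noncomputable def thetaTerm (z p : ℂ) (n : ℤ) : ℂ := z ^ n * p ^ Ring.choose n 2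

/-- The product side `(p;p)_∞ (-z;p)_∞ (-p/z;p)_∞` of Jacobi's triple product identity. -/
noncomputable def tripleProduct (z p : ℂ) : ℂ :=
  qPochInf p p * (qPochInf (-z) p * qPochInf (-(p / z)) p)

/-- The bijection `(n, m) ↦ (n⁺ + m, n⁻ + m)`, which groups the pairs of natural numbers by their
difference. -/
def intProdNatEquiv : ℤ × ℕ ≃ ℕ × ℕ where
  toFun x := (x.1.toNat + x.2, (-x.1).toNat + x.2)
  invFun y := ((y.1 : ℤ) - y.2, min y.1 y.2)
  left_inv := by rintro ⟨n, m⟩; simp only [Prod.mk.injEq]; omega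
  right_inv := by rintro ⟨a, b⟩; simp only [Prod.mk.injEq]; omega

lemma eulerTerm_mul_eulerTerm (hp0 : p ≠ 0) (hz : z ≠ 0) (a b : ℕ) :
    (-1) ^ a * p ^ a.choose 2 / qPoch p p a * (-z) ^ a *
        ((-1) ^ b * p ^ b.choose 2 / qPoch p p b * (-(p / z)) ^ b) =
      thetaTerm z p (a - b) * (p ^ (a * b) / (qPoch p p a * qPoch p p b)) := by
  have hexp : Ring.choose (a : ℤ) 2 + b + Ring.choose (b : ℤ) 2 =
      Ring.choose (a - b : ℤ) 2 + (a * b : ℕ) := by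
    push_cast
    linarith [two_mul_choose_two a, two_mul_choose_two b, two_mul_choose_two (a - b)]
  have hpow : p ^ a.choose 2 * p ^ b * p ^ b.choose 2 =
      p ^ Ring.choose (a - b : ℤ) 2 * p ^ (a * b) := by
    simpa only [zpow_add₀ hp0, Ring.choose_natCast, zpow_natCast] using congrArg (p ^ ·) hexp
  rw [thetaTerm, zpow_sub₀ hz, zpow_natCast, zpow_natCast, neg_pow z, neg_pow (p / z), div_pow]
  field_simp
  rw [← pow_mul, ← pow_mul, pow_mul', pow_mul', neg_one_sq, one_pow, one_pow]
  linear_combination (qPoch p p a)⁻¹ * (qPoch p p b)⁻¹ * hpow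

lemma hasSum_durfeeTerm_toNat (hp : ‖p‖ < 1) (n : ℤ) :
    HasSum (fun m : ℕ => p ^ ((n.toNat + m) * ((-n).toNat + m)) /
      (qPoch p p (n.toNat + m) * qPoch p p ((-n).toNat + m))) (qPochInf p p)⁻¹ := by
  obtain ⟨k, rfl | rfl⟩ := n.eq_nat_or_neg
  · exact (hasSum_durfeeTerm hp k).congr_fun fun m => by simp [durfeeTerm, add_comm, mul_comm]
  · exact (hasSum_durfeeTerm hp k).congr_fun fun m => by simp [durfeeTerm, add_comm]

lemma hasSum_prod_mul {ι κ R : Type*} [NormedRing R] [NormedSpace ℝ R] [FiniteDimensional ℝ R]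
    {f : ι → R} {g : κ → R} {a b : R} (hf : HasSum f a) (hg : HasSum g b) :
    HasSum (fun i : ι × κ => f i.1 * g i.2) (a * b) :=
  hf.mul hg (summable_mul_of_summable_norm' hf.summable.norm hf.summable
    hg.summable.norm hg.summable)

theorem hasSum_thetaTerm (hp : ‖p‖ < 1) (hp0 : p ≠ 0) (hz : z ≠ 0) :
    HasSum (thetaTerm z p) (tripleProduct z p) := by
  have hprod := intProdNatEquiv.hasSum_iff.2
    (hasSum_prod_mul (hasSum_qPochInf hp (-z)) (hasSum_qPochInf hp (-(p / z))))
  have hterm (x : ℤ × ℕ) := eulerTerm_mul_eulerTerm hp0 hz (x.1.toNat + x.2) ((-x.1).toNat + x.2)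
  have hdiff (x : ℤ × ℕ) : ((x.1.toNat + x.2 : ℕ) : ℤ) - ((-x.1).toNat + x.2 : ℕ) = x.1 := by
    omega
  simp only [hdiff] at hterm
  have hfiber (n : ℤ) := (hasSum_durfeeTerm_toNat hp n).mul_left (thetaTerm z p n)
  have hsum := ((hprod.congr_fun fun x => (hterm x).symm).prod_fiberwise hfiber).mul_left
    (qPochInf p p)
  refine hsum.congr_fun fun n => ?_
  have hpp := qPochInf_ne_zero hp hp
  field_simp

end TripleProduct

section QuintupleProduct

variable {q w s : ℂ}

lemma tripleProduct_div (hq0 : q ≠ 0) (w : ℂ) : tripleProduct (q / w) q = tripleProduct w q := by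
  rw [tripleProduct, tripleProduct, div_div_cancel₀ hq0, mul_comm (qPochInf (-(q / w)) q)]

lemma tripleProduct_neg_one (hq : ‖q‖ < 1) : tripleProduct (-1) q = 0 := by
  simp [tripleProduct, qPochInf_one hq]

lemma qPochInf_self_eq_mul_mul (hq : ‖q‖ < 1) :
    qPochInf q q =
      qPochInf (q ^ 3) (q ^ 3) * (qPochInf q (q ^ 3) * qPochInf (q ^ 2) (q ^ 3)) := by
  rw [qPochInf_eq_prod_qPochInf_pow hq q 3]
  simp only [Fin.prod_univ_three, ← pow_succ', Fin.val_zero, Fin.val_one, Fin.val_two]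
  ring_nf

lemma tripleProduct_neg_self_pow_three (hq : ‖q‖ < 1) (hq0 : q ≠ 0) :
    tripleProduct (-q) (q ^ 3) = qPochInf q q := by
  have hdiv : -(q ^ 3 / -q) = q ^ 2 := by field_simp
  rw [qPochInf_self_eq_mul_mul hq, tripleProduct, hdiv, neg_neg]

/-- The bijection `(r, j, n) ↦ (j + r - 2n, n + j)`, which diagonalizes the quadratic form in the
exponent of `q` in a product of theta series with bases `q` and `q²`. -/
def finThreeProdIntEquiv : Fin 3 × (ℤ × ℤ) ≃ ℤ × ℤ where
  toFun x := (x.2.1 + (x.1 : ℕ) - 2 * x.2.2, x.2.2 + x.2.1)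
  invFun y := (⟨((y.1 + 2 * y.2) % 3).toNat, by omega⟩,
    ((y.1 + 2 * y.2) / 3, y.2 - (y.1 + 2 * y.2) / 3))
  left_inv := by
    rintro ⟨⟨r, hr⟩, j, n⟩
    simp only [Prod.mk.injEq, Fin.mk.injEq]
    omega
  right_inv := by
    rintro ⟨a, b⟩
    simp only [Prod.mk.injEq]
    omega

lemma thetaTerm_mul_thetaTerm_sq (hq0 : q ≠ 0) (hw : w ≠ 0) (hs : s ≠ 0) (r j n : ℤ) :
    thetaTerm w q (j + r - 2 * n) * thetaTerm (s * w ^ 2) (q ^ 2) (n + j) =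
      thetaTerm w q r *
        (thetaTerm (s * q ^ r * w ^ 3) (q ^ 3) j * thetaTerm (s * q ^ (3 - 2 * r)) (q ^ 6) n) := by
  have hexp : Ring.choose (j + r - 2 * n) 2 + 2 * Ring.choose (n + j) 2 =
      Ring.choose r 2 + r * j + 3 * Ring.choose j 2 + (3 - 2 * r) * n + 6 * Ring.choose n 2 := by
    linarith [two_mul_choose_two (j + r - 2 * n), two_mul_choose_two (n + j),
      two_mul_choose_two r, two_mul_choose_two j, two_mul_choose_two n]
  have hqpow := congrArg (q ^ ·) hexp
  simp only [zpow_add₀ hq0] at hqpow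
  have hwpow : w ^ (j + r - 2 * n) * w ^ (2 * (n + j)) = w ^ r * w ^ (3 * j) := by
    rw [← zpow_add₀ hw, ← zpow_add₀ hw]
    ring_nf
  have hpow (x : ℂ) (k : ℕ) (m : ℤ) : (x ^ k) ^ m = x ^ (k * m) := by rw [zpow_mul, zpow_natCast]
  simp only [thetaTerm, mul_zpow, ← zpow_mul, hpow, zpow_add₀ hs, Nat.cast_ofNat]
  linear_combination s ^ n * s ^ j *
    (w ^ (j + r - 2 * n) * w ^ (2 * (n + j)) * hqpow + q ^ Ring.choose r 2 * q ^ (r * j) *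
      q ^ (3 * Ring.choose j 2) * q ^ ((3 - 2 * r) * n) * q ^ (6 * Ring.choose n 2) * hwpow)

theorem tripleProduct_mul_tripleProduct_sq (hq : ‖q‖ < 1) (hq0 : q ≠ 0) (hw : w ≠ 0)
    (hs : s ≠ 0) :
    tripleProduct w q * tripleProduct (s * w ^ 2) (q ^ 2) =
      ∑ r : Fin 3, thetaTerm w q (r : ℕ) *
        (tripleProduct (s * q ^ ((r : ℕ) : ℤ) * w ^ 3) (q ^ 3) *
          tripleProduct (s * q ^ (3 - 2 * ((r : ℕ) : ℤ))) (q ^ 6)) := by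
  have htheta (k : ℕ) [NeZero k] {z : ℂ} (hz : z ≠ 0) :
      HasSum (thetaTerm z (q ^ k)) (tripleProduct z (q ^ k)) :=
    hasSum_thetaTerm (norm_pow_lt_one hq k) (pow_ne_zero k hq0) hz
  have hqr (m : ℤ) : s * q ^ m ≠ 0 := mul_ne_zero hs (zpow_ne_zero m hq0)
  have hprod := finThreeProdIntEquiv.hasSum_iff.2 (hasSum_prod_mul (hasSum_thetaTerm hq hq0 hw)
    (htheta 2 (mul_ne_zero hs (pow_ne_zero 2 hw))))
  have hfiber (r : Fin 3) : HasSum (fun y : ℤ × ℤ => thetaTerm w q (r : ℕ) *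
      (thetaTerm (s * q ^ ((r : ℕ) : ℤ) * w ^ 3) (q ^ 3) y.1 *
        thetaTerm (s * q ^ (3 - 2 * ((r : ℕ) : ℤ))) (q ^ 6) y.2)) _ :=
    (hasSum_prod_mul (htheta 3 (mul_ne_zero (hqr _) (pow_ne_zero 3 hw)))
      (htheta 6 (hqr _))).mul_left _
  have hterm (x : Fin 3 × (ℤ × ℤ)) :=
    (thetaTerm_mul_thetaTerm_sq hq0 hw hs (x.1 : ℕ) x.2.1 x.2.2).symm
  exact ((hprod.congr_fun hterm).prod_fiberwise hfiber).unique (hasSum_fintype _)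

theorem quintupleProduct (hq : ‖q‖ < 1) (hq0 : q ≠ 0) (hw : w ≠ 0) :
    tripleProduct w q * tripleProduct (-q * w ^ 2) (q ^ 2) =
      qPochInf (q ^ 2) (q ^ 2) *
        (tripleProduct (-q * w ^ 3) (q ^ 3) + w * tripleProduct (-q ^ 2 * w ^ 3) (q ^ 3)) := by
  have hq2 : tripleProduct (-q ^ 2) (q ^ 6) = qPochInf (q ^ 2) (q ^ 2) := by
    rw [← tripleProduct_neg_self_pow_three (norm_pow_lt_one hq 2) (pow_ne_zero 2 hq0), ← pow_mul]
  have hq4 : tripleProduct (-q ^ 4) (q ^ 6) = qPochInf (q ^ 2) (q ^ 2) := by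
    rw [← tripleProduct_div (pow_ne_zero 6 hq0), ← hq2]
    congr 1
    field_simp
  have h0 : -q * q ^ (3 - 2 * 0 : ℤ) = -q ^ 4 := by rw [mul_zero, sub_zero, zpow_ofNat]; ring
  have h1 : -q * q ^ (3 - 2 * 1 : ℤ) = -q ^ 2 := by norm_num; ring
  have h2 : -q * q ^ (3 - 2 * 2 : ℤ) = -1 := by norm_num; field_simp
  have htheta0 : thetaTerm w q 0 = 1 := by simp [thetaTerm]
  have htheta1 : thetaTerm w q 1 = w := by
    have hchoose : Ring.choose (1 : ℤ) 2 = 0 := by simpa using Ring.choose_natCast (R := ℤ) 1 2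
    simp [thetaTerm, hchoose]
  rw [tripleProduct_mul_tripleProduct_sq hq hq0 hw (neg_ne_zero.2 hq0)]
  simp only [Fin.sum_univ_three, Fin.val_zero, Fin.val_one, Fin.val_two, Nat.cast_zero,
    Nat.cast_one, Nat.cast_ofNat, h0, h1, h2, hq2, hq4, htheta0, htheta1,
    tripleProduct_neg_one (norm_pow_lt_one hq 6), zpow_zero, zpow_one]
  ring_nf

end QuintupleProduct

section Derivative

variable {p q x z : ℂ}

lemma hasDerivAt_qPochInf_logDeriv (hp : ‖p‖ < 1) (hx : x ≠ 0) (hpoch : qPochInf x p ≠ 0) :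
    HasDerivAt (fun y => qPochInf y p) (qPochInf x p * qPochLogDeriv p x / x) x := by
  refine (differentiableAt_qPochInf hp x).hasDerivAt.congr_deriv ?_
  rw [qPochLogDeriv, logDeriv_apply]
  field_simp

lemma hasDerivAt_qPochInf_one (hp : ‖p‖ < 1) :
    HasDerivAt (fun y => qPochInf y p) (-qPochInf p p) 1 := by
  have hshift : (fun y => qPochInf y p) = fun y => (1 - y) * qPochInf (y * p) p :=
    funext (qPochInf_eq_one_sub_mul hp)
  have hinner : HasDerivAt (fun y => qPochInf (y * p) p)
      (deriv (fun y => qPochInf y p) (1 * p) * p) 1 :=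
    HasDerivAt.comp 1 (h₂ := fun y => qPochInf y p) (differentiableAt_qPochInf hp _).hasDerivAt
      (hasDerivAt_mul_const p)
  rw [hshift]
  refine (((hasDerivAt_id' 1).const_sub 1).mul hinner).congr_deriv ?_
  simp

lemma hasDerivAt_tripleProduct {g₁ g₂ : ℂ} (hz : z ≠ 0)
    (h₁ : HasDerivAt (fun y => qPochInf y p) g₁ (-z))
    (h₂ : HasDerivAt (fun y => qPochInf y p) g₂ (-(p / z))) :
    HasDerivAt (fun y => tripleProduct y p)
      (qPochInf p p * (qPochInf (-z) p * (g₂ * (p / z ^ 2)) - g₁ * qPochInf (-(p / z)) p)) z := by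
  have hdiv : HasDerivAt (fun y => -(p / y)) (p / z ^ 2) z := by
    simpa [div_eq_mul_inv] using ((hasDerivAt_inv hz).const_mul p).fun_neg
  have hleft : HasDerivAt (fun y => qPochInf (-y) p) (g₁ * -1) z := h₁.comp z (hasDerivAt_neg z)
  have hright : HasDerivAt (fun y => qPochInf (-(p / y)) p) (g₂ * (p / z ^ 2)) z :=
    HasDerivAt.comp z (h₂ := fun y => qPochInf y p) h₂ hdiv
  refine ((hleft.mul hright).const_mul (qPochInf p p)).congr_deriv ?_
  ring

lemma differentiableAt_tripleProduct (hp : ‖p‖ < 1) (hz : z ≠ 0) :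
    DifferentiableAt ℂ (fun y => tripleProduct y p) z :=
  (hasDerivAt_tripleProduct hz (differentiableAt_qPochInf hp _).hasDerivAt
    (differentiableAt_qPochInf hp _).hasDerivAt).differentiableAt

lemma hasDerivAt_tripleProduct_neg_one (hp : ‖p‖ < 1) :
    HasDerivAt (fun y => tripleProduct y p) (qPochInf p p ^ 3) (-1) := by
  refine (hasDerivAt_tripleProduct (by simp) (by simpa using hasDerivAt_qPochInf_one hp)
    (differentiableAt_qPochInf hp _).hasDerivAt).congr_deriv ?_
  simp only [neg_neg, div_neg, div_one, qPochInf_one hp]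
  ring

lemma hasDerivAt_tripleProduct_logDeriv (hp : ‖p‖ < 1) (hp0 : p ≠ 0) (hz : z ≠ 0)
    (hz₁ : qPochInf (-z) p ≠ 0) (hz₂ : qPochInf (-(p / z)) p ≠ 0) :
    HasDerivAt (fun y => tripleProduct y p)
      (tripleProduct z p * (qPochLogDeriv p (-z) - qPochLogDeriv p (-(p / z))) / z) z := by
  refine (hasDerivAt_tripleProduct hz (hasDerivAt_qPochInf_logDeriv hp (neg_ne_zero.2 hz) hz₁)
    (hasDerivAt_qPochInf_logDeriv hp (neg_ne_zero.2 (div_ne_zero hp0 hz)) hz₂)).congr_deriv ?_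
  rw [tripleProduct]
  field_simp
  ring

lemma hasDerivAt_tripleProduct_neg_mul_pow_three {g : ℂ}
    (h : HasDerivAt (fun y => tripleProduct y p) g z) :
    HasDerivAt (fun w => tripleProduct (-z * w ^ 3) p) (-3 * z * g) (-1) := by
  have hcube : HasDerivAt (fun w => -z * w ^ 3) (-3 * z) (-1) := by
    simpa [mul_comm] using (hasDerivAt_pow 3 (-1 : ℂ)).const_mul (-z)
  have hbase : -z * (-1) ^ 3 = z := by ring
  rw [mul_comm]
  rw [← hbase] at h
  exact HasDerivAt.comp (-1) (h₂ := fun y => tripleProduct y p) h hcube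

lemma hasDerivAt_quintupleProduct_left (hq : ‖q‖ < 1) (hq0 : q ≠ 0) :
    HasDerivAt (fun w => tripleProduct w q * tripleProduct (-q * w ^ 2) (q ^ 2))
      (qPochInf q q ^ 3 * tripleProduct (-q) (q ^ 2)) (-1) := by
  have hbase : -q * (-1) ^ 2 ≠ 0 := by simpa
  have hsq : DifferentiableAt ℂ (fun w => tripleProduct (-q * w ^ 2) (q ^ 2)) (-1) :=
    DifferentiableAt.comp (-1) (g := fun y => tripleProduct y (q ^ 2))
      (differentiableAt_tripleProduct (norm_pow_lt_one hq 2) hbase)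
      ((differentiableAt_pow 2).const_mul (-q))
  refine ((hasDerivAt_tripleProduct_neg_one hq).mul hsq.hasDerivAt).congr_deriv ?_
  simp only [tripleProduct_neg_one hq, zero_mul, add_zero, even_two.neg_one_pow, mul_one]

lemma hasDerivAt_quintupleProduct_right (hq : ‖q‖ < 1) (hq0 : q ≠ 0) :
    HasDerivAt (fun w => qPochInf (q ^ 2) (q ^ 2) *
        (tripleProduct (-q * w ^ 3) (q ^ 3) + w * tripleProduct (-q ^ 2 * w ^ 3) (q ^ 3)))
      (qPochInf (q ^ 2) (q ^ 2) * (tripleProduct q (q ^ 3) *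
        (1 - 6 * (qPochLogDeriv (q ^ 3) (-q) - qPochLogDeriv (q ^ 3) (-q ^ 2))))) (-1) := by
  have hq2 := norm_pow_lt_one hq 2
  have hq3 := norm_pow_lt_one hq 3
  have hq30 : q ^ 3 ≠ 0 := pow_ne_zero 3 hq0
  have hdiv : q ^ 3 / q = q ^ 2 := by field_simp
  have hdiv2 : q ^ 3 / q ^ 2 = q := by field_simp
  have hsymm := tripleProduct_div hq30 q
  have hpoch := qPochInf_ne_zero hq3 (x := -q) (by simpa)
  have hpoch2 := qPochInf_ne_zero hq3 (x := -q ^ 2) (by simpa using hq2)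
  have hT := hasDerivAt_tripleProduct_logDeriv hq3 hq30 hq0 hpoch (by rwa [hdiv])
  have hT2 := hasDerivAt_tripleProduct_logDeriv hq3 hq30 (pow_ne_zero 2 hq0) hpoch2
    (by rwa [hdiv2])
  rw [hdiv] at hT hsymm
  rw [hdiv2, hsymm] at hT2
  refine (((hasDerivAt_tripleProduct_neg_mul_pow_three hT).add ((hasDerivAt_id' (-1)).mul
    (hasDerivAt_tripleProduct_neg_mul_pow_three hT2))).const_mul _).congr_deriv ?_
  have hbase : -q ^ 2 * (-1) ^ 3 = q ^ 2 := by ring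
  rw [hbase, hsymm]
  field_simp
  ring

theorem qPochInf_self_pow_three_mul_tripleProduct (hq : ‖q‖ < 1) (hq0 : q ≠ 0) :
    qPochInf q q ^ 3 * tripleProduct (-q) (q ^ 2) =
      qPochInf (q ^ 2) (q ^ 2) * (tripleProduct q (q ^ 3) *
        (1 - 6 * (qPochLogDeriv (q ^ 3) (-q) - qPochLogDeriv (q ^ 3) (-q ^ 2)))) := by
  refine (hasDerivAt_quintupleProduct_left hq hq0).unique
    ((hasDerivAt_quintupleProduct_right hq hq0).congr_of_eventuallyEq ?_)
  filter_upwards [eventually_ne_nhds (neg_ne_zero.2 one_ne_zero)] with w hw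
  exact quintupleProduct hq hq0 hw

end Derivative

section RamanujanPhi

variable {q : ℂ}

lemma hasSum_zpow_sq (hq : ‖q‖ < 1) (hq0 : q ≠ 0) :
    HasSum (fun n : ℤ => q ^ (n ^ 2)) (tripleProduct q (q ^ 2)) := by
  refine (hasSum_thetaTerm (norm_pow_lt_one hq 2) (pow_ne_zero 2 hq0) hq0).congr_fun fun n => ?_
  have hsq : n ^ 2 = n + 2 * Ring.choose n 2 := by rw [two_mul_choose_two]; ring
  rw [thetaTerm, hsq, zpow_add₀ hq0, zpow_mul, zpow_ofNat]

lemma qPochInf_self_eq_mul (hq : ‖q‖ < 1) :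
    qPochInf q q = qPochInf q (q ^ 2) * qPochInf (q ^ 2) (q ^ 2) := by
  rw [qPochInf_eq_prod_qPochInf_pow hq q 2, Fin.prod_univ_two]
  simp only [Fin.val_zero, Fin.val_one, pow_zero, mul_one, pow_one, ← sq]

lemma qPochInf_neg_self_mul (hq : ‖q‖ < 1) : qPochInf (-q) q * qPochInf q (q ^ 2) = 1 := by
  have hdouble := qPochInf_neg_mul hq q
  have hq2 := norm_pow_lt_one hq 2
  rw [qPochInf_self_eq_mul hq] at hdouble
  refine mul_right_cancel₀ (qPochInf_ne_zero hq2 hq2) ?_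
  linear_combination hdouble

lemma tripleProduct_neg_self_sq (hq : ‖q‖ < 1) (hq0 : q ≠ 0) :
    tripleProduct (-q) (q ^ 2) = qPochInf q q / qPochInf (-q) q := by
  have hdiv : -(q ^ 2 / -q) = q := by field_simp
  have hneg : qPochInf (-q) q ≠ 0 := qPochInf_ne_zero hq (by simpa)
  rw [tripleProduct, hdiv, neg_neg, eq_div_iff hneg, qPochInf_self_eq_mul hq]
  linear_combination qPochInf (q ^ 2) (q ^ 2) * qPochInf q (q ^ 2) * qPochInf_neg_self_mul hq

lemma hasSum_neg_zpow_sq (hq : ‖q‖ < 1) :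
    HasSum (fun n : ℤ => (-q) ^ (n ^ 2)) (qPochInf q q / qPochInf (-q) q) := by
  rcases eq_or_ne q 0 with rfl | hq0
  · have hsingle : HasSum (fun n : ℤ => (-0 : ℂ) ^ (n ^ 2)) ((-0) ^ ((0 : ℤ) ^ 2)) :=
      hasSum_single 0 fun n hn => by rw [neg_zero, zero_zpow _ (pow_ne_zero 2 hn)]
    simpa [qPochInf, zero_pow two_ne_zero] using hsingle
  · simpa [← tripleProduct_neg_self_sq hq hq0] using hasSum_zpow_sq (q := -q) (by simpa) (by simpa)

lemma ramanujanPhi_neg (hq : ‖q‖ < 1) :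
    ramanujanPhi (-q) = qPochInf q q / qPochInf (-q) q :=
  (hasSum_neg_zpow_sq hq).tsum_eq

lemma ramanujanPhi_neg_ne_zero (hq : ‖q‖ < 1) : ramanujanPhi (-q) ≠ 0 := by
  rw [ramanujanPhi_neg hq]
  exact div_ne_zero (qPochInf_ne_zero hq hq) (qPochInf_ne_zero hq (by simpa))

lemma tripleProduct_self_pow_three (hq : ‖q‖ < 1) (hq0 : q ≠ 0) :
    tripleProduct q (q ^ 3) = ramanujanPhi (-q ^ 3) * qPochInf (-q) q := by
  have hq3 := norm_pow_lt_one hq 3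
  have hdiv : q ^ 3 / q = q ^ 2 := by field_simp
  have hneg3 : qPochInf (-q ^ 3) (q ^ 3) ≠ 0 := qPochInf_ne_zero hq3 (by simpa using hq3)
  have hsplit : qPochInf (-q) q =
      qPochInf (-q) (q ^ 3) * qPochInf (-q ^ 2) (q ^ 3) * qPochInf (-q ^ 3) (q ^ 3) := by
    rw [qPochInf_eq_prod_qPochInf_pow hq (-q) 3]
    simp only [Fin.prod_univ_three, neg_mul, ← pow_succ', Fin.val_zero, Fin.val_one, Fin.val_two]
    ring_nf
  rw [tripleProduct, hdiv, ramanujanPhi_neg hq3, hsplit]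
  field_simp

theorem ramanujanPhi_neg_pow_three_div (hq : ‖q‖ < 1) :
    ramanujanPhi (-q) ^ 3 / ramanujanPhi (-q ^ 3) =
      1 - 6 * (qPochLogDeriv (q ^ 3) (-q) - qPochLogDeriv (q ^ 3) (-q ^ 2)) := by
  rw [div_eq_iff (ramanujanPhi_neg_ne_zero (norm_pow_lt_one hq 3))]
  rcases eq_or_ne q 0 with rfl | hq0
  · have hphi : ramanujanPhi 0 = 1 := by
      rw [← neg_zero, ramanujanPhi_neg (by simp)]
      simp [qPochInf]
    simp [qPochLogDeriv, hphi]
  have hpos := qPochInf_ne_zero hq hq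
  have hneg := qPochInf_ne_zero hq (x := -q) (by simpa)
  have hmain := qPochInf_self_pow_three_mul_tripleProduct hq hq0
  rw [tripleProduct_neg_self_sq hq hq0, tripleProduct_self_pow_three hq hq0,
    ← qPochInf_neg_mul hq q] at hmain
  rw [ramanujanPhi_neg hq]
  field_simp at hmain ⊢
  linear_combination hmain

end RamanujanPhi

section WeightedSums

variable {p x : ℂ}

lemma hasSum_pnat_natCast_mul {f : ℕ → ℂ} {s : ℂ} (h : HasSum (fun n : ℕ => n * f n) s) :
    HasSum (fun n : ℕ+ => n * f n) s := by
  refine (PNat.coe_injective.hasSum_iff fun n hn => ?_).2 h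
  obtain rfl : n = 0 := by_contra fun hn0 => hn ⟨⟨n, Nat.pos_of_ne_zero hn0⟩, rfl⟩
  simp

lemma hasSum_pnat_qPochInf_neg (hp : ‖p‖ < 1) (hx : qPochInf (-x) p ≠ 0) :
    HasSum (fun n : ℕ+ => n * (x ^ (n : ℕ) * p ^ (n : ℕ).choose 2) / qPoch p p n)
      (qPochInf (-x) p * qPochLogDeriv p (-x)) := by
  refine (hasSum_pnat_natCast_mul (hasSum_natCast_mul_qPochInf hp hx)).congr_fun fun n => ?_
  have hsign : (-1 : ℂ) ^ (n : ℕ) * (-1) ^ (n : ℕ) = 1 := pow_mul_pow_eq_one n (by norm_num)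
  rw [neg_pow x]
  linear_combination -(n * (x ^ (n : ℕ) * p ^ (n : ℕ).choose 2) / qPoch p p n) * hsign

lemma hasSum_pnat_inv_qPochInf_neg (hp : ‖p‖ < 1) (hx : ‖x‖ < 1) :
    HasSum (fun n : ℕ+ => n * (-1) ^ (n : ℕ) * x ^ (n : ℕ) / qPoch p p n)
      (-(qPochLogDeriv p (-x) / qPochInf (-x) p)) := by
  refine (hasSum_pnat_natCast_mul (hasSum_natCast_mul_inv_qPochInf hp
    (by rwa [norm_neg]))).congr_fun fun n => ?_
  rw [neg_pow x]
  ring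

lemma sq_eq_add_two_mul_choose_two (n : ℕ) : n ^ 2 = n + 2 * n.choose 2 := by
  have hchoose : (n.choose 2 : ℤ) = Ring.choose (n : ℤ) 2 := (Ring.choose_natCast n 2).symm
  zify
  rw [hchoose, two_mul_choose_two]
  ring

lemma pow_three_mul_sq_sub_div_two (x : ℂ) (n : ℕ) :
    x ^ ((3 * n ^ 2 - n) / 2) = x ^ n * (x ^ 3) ^ n.choose 2 := by
  have hexp : (3 * n ^ 2 - n) / 2 = n + 3 * n.choose 2 := by
    have := sq_eq_add_two_mul_choose_two n
    omega
  rw [hexp, pow_add, pow_mul]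

lemma pow_three_mul_sq_add_div_two (x : ℂ) (n : ℕ) :
    x ^ ((3 * n ^ 2 + n) / 2) = (x ^ 2) ^ n * (x ^ 3) ^ n.choose 2 := by
  have hexp : (3 * n ^ 2 + n) / 2 = 2 * n + 3 * n.choose 2 := by
    have := sq_eq_add_two_mul_choose_two n
    omega
  rw [hexp, pow_add, pow_mul, pow_mul]

end WeightedSums

/-- In every series the summation index is `n : ℕ+`, that is, `n = 1, 2, 3, …`; the exponents
`(3 * n ^ 2 ± n) / 2` are exact divisions of natural numbers. The first conjuncts say that all series
and products converge and that no denominator vanishes; the last two are the two identities. -/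
theorem mainTheorem12 (q : ℂ) (hq : ‖q‖ < 1) :
    (Summable (fun n : ℤ => (-q) ^ (n ^ 2)) ∧
      Summable (fun n : ℤ => (-q ^ 3) ^ (n ^ 2)) ∧
      ramanujanPhi (-q ^ 3) ≠ 0) ∧
    (Multipliable (fun i : ℕ => 1 - (-q) * (q ^ 3) ^ i) ∧ qPochInf (-q) (q ^ 3) ≠ 0 ∧
      Multipliable (fun i : ℕ => 1 - (-q ^ 2) * (q ^ 3) ^ i) ∧ qPochInf (-q ^ 2) (q ^ 3) ≠ 0) ∧
    (∀ n : ℕ, qPoch (q ^ 3) (q ^ 3) n ≠ 0) ∧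
    (Summable (fun n : ℕ+ =>
        (n : ℂ) * q ^ ((3 * (n : ℕ) ^ 2 - (n : ℕ)) / 2) / qPoch (q ^ 3) (q ^ 3) n) ∧
      Summable (fun n : ℕ+ =>
        (n : ℂ) * q ^ ((3 * (n : ℕ) ^ 2 + (n : ℕ)) / 2) / qPoch (q ^ 3) (q ^ 3) n) ∧
      Summable (fun n : ℕ+ =>
        (n : ℂ) * (-1) ^ (n : ℕ) * q ^ (n : ℕ) / qPoch (q ^ 3) (q ^ 3) n) ∧
      Summable (fun n : ℕ+ =>
        (n : ℂ) * (-1) ^ (n : ℕ) * q ^ (2 * (n : ℕ)) / qPoch (q ^ 3) (q ^ 3) n)) ∧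
    ramanujanPhi (-q) ^ 3 / ramanujanPhi (-q ^ 3) =
      1 - 6 / qPochInf (-q) (q ^ 3) *
          ∑' n : ℕ+, (n : ℂ) * q ^ ((3 * (n : ℕ) ^ 2 - (n : ℕ)) / 2) / qPoch (q ^ 3) (q ^ 3) n
        + 6 / qPochInf (-q ^ 2) (q ^ 3) *
          ∑' n : ℕ+, (n : ℂ) * q ^ ((3 * (n : ℕ) ^ 2 + (n : ℕ)) / 2) / qPoch (q ^ 3) (q ^ 3) n ∧
    ramanujanPhi (-q) ^ 3 / ramanujanPhi (-q ^ 3) =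
      1 + 6 * qPochInf (-q) (q ^ 3) *
          (∑' n : ℕ+, (n : ℂ) * (-1) ^ (n : ℕ) * q ^ (n : ℕ) / qPoch (q ^ 3) (q ^ 3) n)
        - 6 * qPochInf (-q ^ 2) (q ^ 3) *
          ∑' n : ℕ+, (n : ℂ) * (-1) ^ (n : ℕ) * q ^ (2 * (n : ℕ)) / qPoch (q ^ 3) (q ^ 3) n := by
  have hq2 := norm_pow_lt_one hq 2
  have hq3 := norm_pow_lt_one hq 3
  have hpoch : qPochInf (-q) (q ^ 3) ≠ 0 := qPochInf_ne_zero hq3 (by rwa [norm_neg])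
  have hpoch2 : qPochInf (-q ^ 2) (q ^ 3) ≠ 0 := qPochInf_ne_zero hq3 (by rwa [norm_neg])
  have hgauss := hasSum_pnat_qPochInf_neg hq3 hpoch
  have hgauss2 := hasSum_pnat_qPochInf_neg hq3 hpoch2
  have hgeom := hasSum_pnat_inv_qPochInf_neg hq3 hq
  have hgeom2 := hasSum_pnat_inv_qPochInf_neg hq3 hq2
  simp only [pow_three_mul_sq_sub_div_two, pow_three_mul_sq_add_div_two, pow_mul]
  refine ⟨⟨(hasSum_neg_zpow_sq hq).summable, (hasSum_neg_zpow_sq hq3).summable,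
      ramanujanPhi_neg_ne_zero hq3⟩,
    ⟨multipliable_one_sub_mul_pow hq3 _, hpoch, multipliable_one_sub_mul_pow hq3 _, hpoch2⟩,
    qPoch_ne_zero hq3 hq3,
    ⟨hgauss.summable, hgauss2.summable, hgeom.summable, hgeom2.summable⟩, ?_, ?_⟩
  · rw [hgauss.tsum_eq, hgauss2.tsum_eq, ramanujanPhi_neg_pow_three_div hq]
    field_simp
    ring
  · rw [hgeom.tsum_eq, hgeom2.tsum_eq, ramanujanPhi_neg_pow_three_div hq]
    field_simp
    ring
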